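/- Let $G$ be a connected (real, finite-dimensional) Lie group that is nilpotent, and let $\phi : G \to G$ be a surjective endomorphism of $G$, that is, a surjective smooth group homomorphism. Then $\phi$ is a proper map, i.e. the preimage under $\phi$ of every compact subset of $G$ is compact. -/

import Mathlib

open scoped Manifold ContDiff

/-! Compare volume growth. For a compact generating neighbourhood `V` of `1`, nilpotency bounds `μ
(V ^ n)` by a polynomial in `n` (`exists_measure_pow_le_of_isNilpotent`, from the growth of finite
sets). If the kernel were not compact, it would contain arbitrarily many points with disjoint
translates of a fixed open set. Multiplying these with a lifted packing of `V ^ n` gives `N * μ (V ^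
n) ≤ μ (V ^ (M * n))` for large `n`, with `M` independent of `N` (`exists_mul_measure_pow_le`).
Taking `N` a large power of `M` contradicts the polynomial bound. So the kernel is compact, and
openness of the map gives properness. -/

open scoped Pointwise

/-! ### Growth of finite sets in nilpotent groups. -/

section PolynomialGrowth

variable {G : Type*} [Group G]

/-- The commutator of `h⁻¹` and `a⁻¹`, that is, the element `c` such that `a⁻¹ * h * a = h * c`. -/
def conjDefect (a h : G) : G := h⁻¹ * a⁻¹ * h * a

lemma inv_mul_mul_eq_mul_conjDefect (a h : G) : a⁻¹ * h * a = h * conjDefect a h := by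
  simp [conjDefect, mul_assoc]

@[simp] lemma conjDefect_one (a : G) : conjDefect a 1 = 1 := by
  simp [conjDefect]

lemma conjDefect_mem_lowerCentralSeries {a h : G} {i : ℕ}
    (hh : h ∈ (⊤ : Subgroup G).lowerCentralSeries i) :
    conjDefect a h ∈ (⊤ : Subgroup G).lowerCentralSeries (i + 1) := by
  simpa [conjDefect, commutatorElement_def] using
    Subgroup.commutator_mem_commutator (inv_mem hh) (Subgroup.mem_top a⁻¹)

lemma conjDefect_iterate_mem_lowerCentralSeries {a h : G} {i : ℕ}
    (hh : h ∈ (⊤ : Subgroup G).lowerCentralSeries i) (j : ℕ) :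
    (conjDefect a)^[j] h ∈ (⊤ : Subgroup G).lowerCentralSeries (i + j) := by
  induction j with
  | zero => exact hh
  | succ j ih =>
    rw [Function.iterate_succ_apply']
    exact conjDefect_mem_lowerCentralSeries ih

variable [DecidableEq G]

/-- A finite set has polynomial growth if the cardinality of its `n`-fold product set is bounded
by a polynomial in `n`. -/
def HasPolynomialGrowth (F : Finset G) : Prop :=
  ∃ d : ℕ, ∀ n : ℕ, (F ^ n).card ≤ (n + 1) ^ d

lemma HasPolynomialGrowth.mono {F F' : Finset G} (h : F ⊆ F') (hF' : HasPolynomialGrowth F') :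
    HasPolynomialGrowth F := by
  obtain ⟨d, hd⟩ := hF'
  exact ⟨d, fun n => (Finset.card_le_card (Finset.pow_subset_pow_left h)).trans (hd n)⟩

/-- Each further conjugation by `a` splits off a factor killed by one fewer iterate, so word length
obeys a Pascal-type recursion and stays polynomial in `t`. -/
lemma conj_pow_mem_pow {a : G} {H : Finset G} (h1 : 1 ∈ H)
    (hH : ∀ h ∈ H, conjDefect a h ∈ H) (m : ℕ) :
    ∀ h ∈ H, (conjDefect a)^[m] h = 1 → ∀ t : ℕ, (a ^ t)⁻¹ * h * a ^ t ∈ H ^ (t + 1) ^ m := by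
  induction m with
  | zero =>
    intro h hh h' t
    simp only [Function.iterate_zero, id_eq] at h'
    simpa [h'] using h1
  | succ m ih =>
    intro h hh h' t
    induction t with
    | zero => simpa using hh
    | succ t iht =>
      have e : (a ^ (t + 1))⁻¹ * h * a ^ (t + 1)
          = ((a ^ t)⁻¹ * h * a ^ t) * ((a ^ t)⁻¹ * conjDefect a h * a ^ t) := by
        have := inv_mul_mul_eq_mul_conjDefect a h
        calc (a ^ (t + 1))⁻¹ * h * a ^ (t + 1) = (a ^ t)⁻¹ * (a⁻¹ * h * a) * a ^ t := by
              rw [pow_succ']; group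
          _ = _ := by rw [this]; group
      rw [e]
      have h2 := ih _ (hH h hh) (by simpa [Function.iterate_succ_apply] using h') t
      have h3 := Finset.mul_mem_mul iht h2
      rw [← pow_add] at h3
      refine Finset.pow_subset_pow_right h1 ?_ h3
      calc (t + 1) ^ (m + 1) + (t + 1) ^ m = (t + 1 + 1) * (t + 1) ^ m := by ring
        _ ≤ (t + 1 + 1) * (t + 1 + 1) ^ m := by gcongr; omega
        _ = _ := by ring

/-- Collect all letters `a` on the left: each letter of `H` passed over becomes a conjugate of
length at most `(n + 1) ^ m`. -/
lemma insert_pow_subset {a : G} {H : Finset G} (h1 : 1 ∈ H)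
    (hH : ∀ h ∈ H, conjDefect a h ∈ H) {m : ℕ} (hm : ∀ h ∈ H, (conjDefect a)^[m] h = 1) (n : ℕ) :
    insert a H ^ n ⊆
      (Finset.range (n + 1)).biUnion fun s => {a ^ s} * H ^ (n * (n + 1) ^ m) := by
  induction n with
  | zero =>
    intro x hx
    simpa using hx
  | succ n ih =>
    intro x hx
    rw [pow_succ'] at hx
    obtain ⟨b, hb, y, hy, rfl⟩ := Finset.mem_mul.1 hx
    obtain ⟨s, hs, hy⟩ := Finset.mem_biUnion.1 (ih hy)
    obtain ⟨_, ha, w, hw, rfl⟩ := Finset.mem_mul.1 hy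
    rw [Finset.mem_singleton] at ha
    subst ha
    rw [Finset.mem_range] at hs
    rw [Finset.mem_biUnion]
    have hpow : n * (n + 1) ^ m + (n + 1) ^ m ≤ (n + 1) * (n + 1 + 1) ^ m := by
      calc _ = (n + 1) * (n + 1) ^ m := by ring
        _ ≤ _ := by gcongr; omega
    rcases Finset.mem_insert.1 hb with rfl | hb
    · refine ⟨s + 1, by simpa using hs, ?_⟩
      rw [← mul_assoc, ← pow_succ']
      exact Finset.mul_mem_mul (Finset.mem_singleton_self _)
        (Finset.pow_subset_pow_right h1 (by omega) hw)
    · refine ⟨s, by simp; omega, ?_⟩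
      have e : b * (a ^ s * w) = a ^ s * (((a ^ s)⁻¹ * b * a ^ s) * w) := by group
      rw [e]
      refine Finset.mul_mem_mul (Finset.mem_singleton_self _) ?_
      have h3 := Finset.mul_mem_mul (conj_pow_mem_pow h1 hH m b hb (hm b hb) s) hw
      rw [← pow_add] at h3
      refine Finset.pow_subset_pow_right h1 (le_trans ?_ hpow) h3
      rw [add_comm]
      gcongr
      omega

lemma HasPolynomialGrowth.insert {a : G} {H : Finset G} (hg : HasPolynomialGrowth H) (h1 : 1 ∈ H)
    (hH : ∀ h ∈ H, conjDefect a h ∈ H) {m : ℕ} (hm : ∀ h ∈ H, (conjDefect a)^[m] h = 1) :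
    HasPolynomialGrowth (insert a H) := by
  obtain ⟨d, hd⟩ := hg
  refine ⟨1 + (m + 1) * d, fun n => ?_⟩
  calc (Insert.insert a H ^ n).card ≤ _ := Finset.card_le_card (insert_pow_subset h1 hH hm n)
    _ ≤ ∑ s ∈ Finset.range (n + 1), (({a ^ s} : Finset G) * H ^ (n * (n + 1) ^ m)).card :=
        Finset.card_biUnion_le
    _ ≤ ∑ s ∈ Finset.range (n + 1), (n * (n + 1) ^ m + 1) ^ d := by
        refine Finset.sum_le_sum fun s _ => ?_
        rw [Finset.card_singleton_mul]
        exact hd _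
    _ = (n + 1) * (n * (n + 1) ^ m + 1) ^ d := by simp
    _ ≤ (n + 1) * ((n + 1) ^ (m + 1)) ^ d := by
        gcongr
        rw [pow_succ']
        nlinarith [Nat.one_le_pow m (n + 1) (by omega)]
    _ = _ := by rw [← pow_mul, pow_add, pow_one]

/-- Elements of `S` are removed one at a time. `F` is arbitrary so that it can absorb the iterated
commutators with the removed element, which lie one step deeper. -/
lemma hasPolynomialGrowth_union_of_lowerCentralSeries {c i : ℕ}
    (hc : (⊤ : Subgroup G).lowerCentralSeries c = ⊥)
    (hi : ∀ F : Finset G, (∀ x ∈ F, x ∈ (⊤ : Subgroup G).lowerCentralSeries (i + 1)) →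
      HasPolynomialGrowth F) (S : Finset G) :
    (∀ x ∈ S, x ∈ (⊤ : Subgroup G).lowerCentralSeries i) →
    ∀ F : Finset G, (∀ x ∈ F, x ∈ (⊤ : Subgroup G).lowerCentralSeries (i + 1)) →
      HasPolynomialGrowth (S ∪ F) := by
  induction S using Finset.induction_on with
  | empty => intro _ F hF; simpa using hi F hF
  | insert a S _ ih =>
    intro hS F hF
    have hone : ∀ j, (conjDefect a)^[j] (1 : G) = 1 := fun j =>
      Function.iterate_fixed (conjDefect_one a) j
    have hvanish : ∀ x j, c ≤ j → (conjDefect a)^[j] x = 1 := fun x j hj => by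
      have := conjDefect_iterate_mem_lowerCentralSeries (a := a) (h := x) (i := 0)
        (by simp) j
      rw [zero_add] at this
      have := Subgroup.lowerCentralSeries_antitone _ hj this
      rwa [hc, Subgroup.mem_bot] at this
    -- the union of `F` with all iterated commutators with `a`
    let F' : Finset G := {1} ∪ F ∪
      (Finset.range c).biUnion fun j => (S ∪ F).image (conjDefect a)^[j + 1]
    have hF' : ∀ x ∈ F', x ∈ (⊤ : Subgroup G).lowerCentralSeries (i + 1) := by
      intro x hx
      simp only [F', Finset.mem_union, Finset.mem_singleton, Finset.mem_biUnion,
        Finset.mem_image] at hx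
      rcases hx with (rfl | hx) | ⟨j, -, y, hy, rfl⟩
      · exact one_mem _
      · exact hF x hx
      · have hy' : y ∈ (⊤ : Subgroup G).lowerCentralSeries i := by
          rcases hy with hy | hy
          · exact hS y (Finset.mem_insert_of_mem hy)
          · exact Subgroup.lowerCentralSeries_antitone _ (Nat.le_succ i) (hF y hy)
        exact Subgroup.lowerCentralSeries_antitone _ (by omega)
          (conjDefect_iterate_mem_lowerCentralSeries hy' (j + 1))
    have hiter : ∀ y, y ∈ S ∪ F → ∀ j, (conjDefect a)^[j + 1] y ∈ F' := by
      intro y hy j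
      by_cases hj : j < c
      · exact Finset.mem_union_right _ (Finset.mem_biUnion.2
          ⟨j, Finset.mem_range.2 hj, Finset.mem_image_of_mem _ hy⟩)
      · rw [hvanish y (j + 1) (by omega)]
        simp [F']
    have hg := ih (fun x hx => hS x (Finset.mem_insert_of_mem hx)) F' hF'
    have h1 : (1 : G) ∈ S ∪ F' := by simp [F']
    have hclosed : ∀ h ∈ S ∪ F', conjDefect a h ∈ S ∪ F' := by
      intro h hh
      rcases Finset.mem_union.1 hh with hh | hh
      · exact Finset.mem_union_right _ (hiter h (Finset.mem_union_left _ hh) 0)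
      · rcases Finset.mem_union.1 hh with hh | hh
        · rcases Finset.mem_union.1 hh with hh | hh
          · rw [Finset.mem_singleton.1 hh, conjDefect_one]
            exact h1
          · exact Finset.mem_union_right _ (hiter h (Finset.mem_union_right _ hh) 0)
        · obtain ⟨j, -, hh⟩ := Finset.mem_biUnion.1 hh
          obtain ⟨y, hy, rfl⟩ := Finset.mem_image.1 hh
          rw [← Function.iterate_succ_apply' (conjDefect a)]
          exact Finset.mem_union_right _ (hiter y hy (j + 1))
    refine (hg.insert h1 hclosed (m := c) fun h _ => hvanish h c le_rfl).mono ?_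
    rw [Finset.insert_union]
    refine Finset.insert_subset_insert _ (Finset.union_subset_union_right ?_)
    exact Finset.subset_union_right.trans Finset.subset_union_left

/-- Finite subsets of nilpotent groups have polynomial growth. -/
theorem hasPolynomialGrowth_of_isNilpotent [Group.IsNilpotent G] (F : Finset G) :
    HasPolynomialGrowth F := by
  obtain ⟨c, hc⟩ := Subgroup.nilpotent_iff_lowerCentralSeries.1 ‹Group.IsNilpotent G›
  have key : ∀ k i : ℕ, i + k = c → ∀ F : Finset G,
      (∀ x ∈ F, x ∈ (⊤ : Subgroup G).lowerCentralSeries i) → HasPolynomialGrowth F := by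
    intro k
    induction k with
    | zero =>
      rintro i rfl F hF
      rw [add_zero] at hc
      refine HasPolynomialGrowth.mono (F' := {1}) (fun x hx => ?_) ⟨0, fun n => by simp⟩
      have := hF x hx
      rw [hc, Subgroup.mem_bot] at this
      simp [this]
    | succ k ih =>
      intro i hik F hF
      simpa using hasPolynomialGrowth_union_of_lowerCentralSeries hc (ih (i + 1) (by omega)) F hF ∅
        (by simp)
  exact key c 0 (by omega) F (by simp)

end PolynomialGrowth
-- Exhaustion by powers of a neighbourhood of the identity.
section CompactGeneration

open Topology

variable {G : Type*} [Group G] [TopologicalSpace G] [IsTopologicalGroup G]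

lemma exists_mem_pow_of_connectedSpace [ConnectedSpace G] {V : Set G} (hV1 : V ∈ 𝓝 (1 : G))
    (hVinv : V⁻¹ = V) (x : G) : ∃ n : ℕ, x ∈ V ^ n := by
  have hopen : IsOpen (Subgroup.closure V : Set G) :=
    Subgroup.isOpen_of_mem_nhds (g := 1) _ (Filter.mem_of_superset hV1 Subgroup.subset_closure)
  have huniv : (Subgroup.closure V : Set G) = Set.univ :=
    IsClopen.eq_univ ⟨Subgroup.isClosed_of_isOpen _ hopen, hopen⟩ ⟨1, one_mem _⟩
  have hx : x ∈ Subgroup.closure V := by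
    rw [← SetLike.mem_coe, huniv]
    trivial
  induction hx using Subgroup.closure_induction with
  | mem x hx => exact ⟨1, by simpa using hx⟩
  | one => exact ⟨0, by simp⟩
  | mul x y _ _ hx hy =>
    obtain ⟨m, hm⟩ := hx
    obtain ⟨n, hn⟩ := hy
    exact ⟨m + n, by rw [pow_add]; exact Set.mul_mem_mul hm hn⟩
  | inv x _ hx =>
    obtain ⟨n, hn⟩ := hx
    refine ⟨n, ?_⟩
    rw [← hVinv, inv_pow]
    exact Set.inv_mem_inv.2 hn

lemma pow_subset_interior_pow_succ {V : Set G} (hV1 : V ∈ 𝓝 (1 : G)) (n : ℕ) :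
    V ^ n ⊆ interior (V ^ (n + 1)) := by
  intro x hx
  rw [pow_succ]
  refine subset_interior_mul_right ⟨x, hx, 1, mem_interior_iff_mem_nhds.2 hV1, ?_⟩
  simp

/-- If the powers of a neighbourhood `V` of `1` exhaust `G`, then every compact set is contained
in the image of a power of `V` under a given surjective open map. -/
lemma IsCompact.exists_subset_image_pow {X : Type*} [TopologicalSpace X] {V : Set G}
    (hV1 : V ∈ 𝓝 (1 : G)) (hVg : ∀ x : G, ∃ n : ℕ, x ∈ V ^ n) {f : G → X} (hf : IsOpenMap f)
    (hfs : Function.Surjective f) {C : Set X} (hC : IsCompact C) :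
    ∃ n : ℕ, C ⊆ f '' V ^ n := by
  obtain ⟨n, hn⟩ := hC.elim_directed_cover (fun n : ℕ => f '' interior (V ^ n))
    (fun n => hf _ isOpen_interior) (fun x _ => by
      obtain ⟨y, rfl⟩ := hfs x
      obtain ⟨n, hn⟩ := hVg y
      exact Set.mem_iUnion.2 ⟨n + 1, y, pow_subset_interior_pow_succ hV1 n hn, rfl⟩)
    (Monotone.directed_le fun m n hmn => Set.image_mono (interior_mono
      (Set.pow_subset_pow_right (mem_of_mem_nhds hV1) hmn)))
  exact ⟨n, hn.trans (Set.image_mono interior_subset)⟩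

lemma IsCompact.exists_subset_pow {V : Set G} (hV1 : V ∈ 𝓝 (1 : G))
    (hVg : ∀ x : G, ∃ n : ℕ, x ∈ V ^ n) {C : Set G} (hC : IsCompact C) :
    ∃ n : ℕ, C ⊆ V ^ n := by
  simpa using hC.exists_subset_image_pow hV1 hVg IsOpenMap.id Function.surjective_id

lemma IsCompact.set_pow {V : Set G} (hV : IsCompact V) (n : ℕ) : IsCompact (V ^ n) := by
  induction n with
  | zero => simp
  | succ n ih => rw [pow_succ]; exact ih.mul hV

end CompactGeneration

/-! ### Packings by translates of a set. -/

section Packing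

variable {G : Type*} [Group G]

/-- If no finite packing of `C` by translates of `W` is maximal, there are arbitrarily large
ones. -/
lemma exists_packing_card_eq {C W : Set G} (hW : W.Nonempty)
    (h : ∀ S : Finset G, (S : Set G) ⊆ C → (S : Set G).PairwiseDisjoint (· • W) →
      ¬ C ⊆ S * (W * W⁻¹)) (N : ℕ) :
    ∃ S : Finset G, (S : Set G) ⊆ C ∧ (S : Set G).PairwiseDisjoint (· • W) ∧ S.card = N := by
  classical
  induction N with
  | zero => exact ⟨∅, by simp, by simp, rfl⟩
  | succ N ih =>
    obtain ⟨S, hSC, hS, hcard⟩ := ih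
    obtain ⟨x, hxC, hx⟩ := Set.not_subset.1 (h S hSC hS)
    have hxS : x ∉ S := fun hxS => hx
      ⟨x, hxS, 1, ⟨hW.some, hW.some_mem, _, Set.inv_mem_inv.2 hW.some_mem, by simp⟩, by simp⟩
    refine ⟨insert x S, ?_, ?_, by rw [Finset.card_insert_of_notMem hxS, hcard]⟩
    · rw [Finset.coe_insert]
      exact Set.insert_subset hxC hSC
    · rw [Finset.coe_insert]
      refine hS.insert fun s hs _ => ?_
      rw [Set.disjoint_left]
      rintro _ ⟨w, hw, rfl⟩ ⟨w', hw', e⟩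
      refine hx ⟨s, hs, w' * w⁻¹, ⟨w', hw', w⁻¹, Set.inv_mem_inv.2 hw, rfl⟩, ?_⟩
      simp only [smul_eq_mul] at e ⊢
      rw [← mul_assoc, e, mul_inv_cancel_right]

variable [TopologicalSpace G] [IsTopologicalGroup G]

lemma IsCompact.exists_maximal_packing {C W : Set G} (hC : IsCompact C) (hWo : IsOpen W)
    (hW : W.Nonempty) :
    ∃ S : Finset G, (S : Set G) ⊆ C ∧ (S : Set G).PairwiseDisjoint (· • W) ∧
      C ⊆ S * (W * W⁻¹) := by
  by_contra! h
  obtain ⟨t, ht⟩ := compact_covered_by_mul_left_translates hC (V := W⁻¹)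
    (by rw [hWo.inv.interior_eq]; exact hW.inv)
  obtain ⟨S, hSC, hS, hcard⟩ := exists_packing_card_eq hW h (t.card + 1)
  have hmem : ∀ x : G, ∃ g : G, x ∈ S → g ∈ t ∧ g * x ∈ W⁻¹ := fun x => by
    by_cases hx : x ∈ S
    · obtain ⟨g, hg, hgx⟩ := Set.mem_iUnion₂.1 (ht (hSC hx))
      exact ⟨g, fun _ => ⟨hg, hgx⟩⟩
    · exact ⟨1, fun h => absurd h hx⟩
  choose g hg using hmem
  -- Two packing points sharing a `g` would both have `g⁻¹` in their translate of `W`.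
  obtain ⟨x, hx, y, hy, hxy, e⟩ := Finset.exists_ne_map_eq_of_card_lt_of_maps_to
    (s := S) (t := t) (by omega) (f := g) (fun x hx => (hg x hx).1)
  have hgx : (g x)⁻¹ ∈ x • W := ⟨_, (hg x hx).2, by simp⟩
  have hgy : (g x)⁻¹ ∈ y • W := ⟨_, (hg y hy).2, by simp [e]⟩
  exact Set.disjoint_left.1 (hS hx hy hxy) hgx hgy

end Packing

/-! ### Upper and lower bounds for Haar volume growth. -/

section Volume

open Topology MeasureTheory

lemma measure_finset_mul_le {G : Type*} [Group G] [MeasurableSpace G] [MeasurableMul G]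
    (μ : Measure G) [μ.IsMulLeftInvariant] (F : Finset G) (V : Set G) : μ (F * V) ≤ F.card * μ V := by
  calc μ (F * V) ≤ μ (⋃ x ∈ F, x • V) := measure_mono (by
        rintro _ ⟨x, hx, v, hv, rfl⟩
        exact Set.mem_iUnion₂.2 ⟨x, hx, v, hv, rfl⟩)
    _ ≤ ∑ x ∈ F, μ (x • V) := measure_biUnion_finset_le _ _
    _ = _ := by simp [measure_smul]

variable {G : Type*} [Group G] [TopologicalSpace G] [IsTopologicalGroup G]
  [MeasurableSpace G] [BorelSpace G] (μ : Measure G) [μ.IsMulLeftInvariant]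

/-- Powers of a compact neighbourhood of `1` in a nilpotent group have polynomially bounded
volume. -/
lemma exists_measure_pow_le_of_isNilpotent [Group.IsNilpotent G] {V : Set G} (hV : IsCompact V)
    (hV1 : V ∈ 𝓝 (1 : G)) :
    ∃ d : ℕ, ∀ n : ℕ, n ≠ 0 → μ (V ^ n) ≤ n ^ d * μ V := by
  classical
  obtain ⟨t, ht⟩ := compact_covered_by_mul_left_translates (hV.set_pow 2) (V := V)
    ⟨1, mem_interior_iff_mem_nhds.2 hV1⟩
  obtain ⟨d, hd⟩ := hasPolynomialGrowth_of_isNilpotent (t.image (·⁻¹))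
  have hsub : V ^ 2 ⊆ (t.image (·⁻¹) : Finset G) * V := fun x hx => by
    obtain ⟨g, hg, hgx⟩ := Set.mem_iUnion₂.1 (ht hx)
    exact ⟨g⁻¹, Finset.mem_coe.2 (Finset.mem_image_of_mem _ hg), g * x, hgx, by simp⟩
  refine ⟨d, fun n hn => ?_⟩
  have h := Set.pow_subset_pow_mul_of_sq_subset_mul hsub hn
  rw [← Finset.coe_pow] at h
  refine (measure_mono h).trans ((measure_finset_mul_le μ _ _).trans ?_)
  gcongr
  have := hd (n - 1)
  rw [Nat.sub_add_cancel (Nat.one_le_iff_ne_zero.2 hn)] at this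
  exact_mod_cast this

/-- If the kernel of an open surjective endomorphism is not compact, then the volume of powers of a
generating compact neighbourhood of `1` grows faster than any polynomial. -/
lemma exists_mul_measure_pow_le [T2Space G] [μ.IsOpenPosMeasure] [IsFiniteMeasureOnCompacts μ]
    {V : Set G} (hV : IsCompact V) (hV1 : V ∈ 𝓝 (1 : G)) (hVg : ∀ x : G, ∃ n : ℕ, x ∈ V ^ n)
    {φ : G →* G} (hφ : Continuous φ) (hφo : IsOpenMap φ) (hφs : Function.Surjective φ)
    (hker : ¬ IsCompact (φ.ker : Set G)) :
    ∃ M : ℕ, 2 ≤ M ∧ ∀ N : ℕ, ∃ n₁ : ℕ, n₁ ≠ 0 ∧ ∀ n, n₁ ≤ n →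
      N * μ (V ^ n) ≤ μ (V ^ (M * n)) := by
  have h1V : (1 : G) ∈ V := mem_of_mem_nhds hV1
  obtain ⟨m, hm⟩ := hV.exists_subset_image_pow hV1 hVg hφo hφs
  have hlift : ∀ n, V ^ n ⊆ φ '' V ^ (m * n) := fun n => by
    rw [pow_mul, Set.image_pow]
    exact Set.pow_subset_pow_left hm
  set U := interior V with hU
  have h1U : (1 : G) ∈ U := mem_interior_iff_mem_nhds.2 hV1
  have hUo : IsOpen U := isOpen_interior
  have hUV : U ⊆ V := interior_subset
  have hWo : IsOpen (φ '' U) := hφo _ hUo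
  have hWne : (φ '' U).Nonempty := ⟨_, 1, h1U, rfl⟩
  have ha : μ U ≠ 0 := (hUo.measure_pos μ ⟨1, h1U⟩).ne'
  have hb : μ (φ '' U * (φ '' U)⁻¹) ≠ ⊤ := by
    have hc : IsCompact (φ '' V * (φ '' V)⁻¹) := (hV.image hφ).mul (hV.image hφ).inv
    refine ((measure_mono ?_).trans_lt hc.measure_lt_top).ne
    exact Set.mul_subset_mul (Set.image_mono hUV) (Set.inv_subset_inv.2 (Set.image_mono hUV))
  -- Lifts cost `m * n`; the kernel point and the element of `U` cost at most `n` more. The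
  -- remaining `n` only secures `2 ≤ M`.
  refine ⟨m + 2, by omega, fun N => ?_⟩
  -- `k` kernel translates of `U` outweigh both the factor `N` and the loss in passing from a
  -- packing to a cover.
  obtain ⟨k, hk⟩ := ENNReal.exists_nat_mul_gt ha (ENNReal.mul_ne_top (ENNReal.natCast_ne_top N) hb)
  obtain ⟨T, hTK, hT, hTcard⟩ := exists_packing_card_eq (C := (φ.ker : Set G)) (W := U) ⟨1, h1U⟩
    (fun S _ _ hS => hker (by
      have hcl : IsClosed (φ.ker : Set G) := by
        have : (φ.ker : Set G) = φ ⁻¹' {1} := by ext; simp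
        rw [this]
        exact isClosed_singleton.preimage hφ
      have hc : IsCompact ((S : Set G) * (V * V⁻¹)) := S.finite_toSet.isCompact.mul (hV.mul hV.inv)
      exact hc.of_isClosed_subset hcl (hS.trans (Set.mul_subset_mul_left
        (Set.mul_subset_mul hUV (Set.inv_subset_inv.2 hUV)))))) k
  obtain ⟨n₀, hn₀⟩ := T.finite_toSet.isCompact.exists_subset_pow hV1 hVg
  refine ⟨n₀ + 1, by omega, fun n hn => ?_⟩
  obtain ⟨S, hSC, hS, hcov⟩ := (hV.set_pow n).exists_maximal_packing hWo hWne
  have hσ : ∀ s : G, ∃ x : G, s ∈ S → x ∈ V ^ (m * n) ∧ φ x = s := fun s => by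
    by_cases hs : s ∈ S
    · obtain ⟨x, hx, e⟩ := hlift n (hSC hs)
      exact ⟨x, fun _ => ⟨hx, e⟩⟩
    · exact ⟨1, fun h => absurd h hs⟩
  choose σ hσ using hσ
  -- Applying `φ` separates different `s`; for equal `s`, the packing `T` separates.
  have hdisj : ((S ×ˢ T : Finset (G × G)) : Set (G × G)).PairwiseDisjoint
      (fun p => (σ p.1 * p.2) • U) := by
    rintro ⟨s, t⟩ hst ⟨s', t'⟩ hst' hne
    simp only [Finset.coe_product, Set.mem_prod, Finset.mem_coe] at hst hst'
    rw [Function.onFun, Set.disjoint_left]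
    rintro _ ⟨u, hu, rfl⟩ ⟨u', hu', e⟩
    simp only [smul_eq_mul] at e
    have ht : φ t = 1 := hTK hst.2
    have ht' : φ t' = 1 := hTK hst'.2
    have hss : s = s' := by
      by_contra hss
      have e' := congrArg φ e
      simp only [map_mul, ht, ht', mul_one, (hσ s hst.1).2, (hσ s' hst'.1).2] at e'
      exact Set.disjoint_left.1 (hS hst.1 hst'.1 hss) ⟨φ u, ⟨u, hu, rfl⟩, rfl⟩
        ⟨φ u', ⟨u', hu', rfl⟩, e'⟩
    subst hss
    have htt : t = t' := by
      by_contra htt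
      rw [mul_assoc, mul_assoc] at e
      exact Set.disjoint_left.1 (hT hst.2 hst'.2 htt) ⟨u, hu, rfl⟩ ⟨u', hu', mul_left_cancel e⟩
    exact hne (by rw [htt])
  have hsub : (⋃ p ∈ S ×ˢ T, (σ p.1 * p.2) • U) ⊆ V ^ ((m + 2) * n) := by
    refine Set.iUnion₂_subset fun p hp => ?_
    rw [Finset.mem_product] at hp
    rintro _ ⟨u, hu, rfl⟩
    have h := Set.mul_mem_mul (Set.mul_mem_mul (hσ _ hp.1).1 (hn₀ hp.2)) (hUV hu)
    rw [← pow_add, ← pow_succ] at h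
    refine Set.pow_subset_pow_right h1V ?_ h
    nlinarith
  calc N * μ (V ^ n) ≤ N * (S.card * μ (φ '' U * (φ '' U)⁻¹)) := by
        gcongr
        exact (measure_mono hcov).trans (measure_finset_mul_le μ _ _)
    _ = S.card * (N * μ (φ '' U * (φ '' U)⁻¹)) := by ring
    _ ≤ S.card * (k * μ U) := by gcongr
    _ = ∑ p ∈ S ×ˢ T, μ ((σ p.1 * p.2) • U) := by
        simp [measure_smul, Finset.card_product, hTcard, mul_assoc]
    _ = μ (⋃ p ∈ S ×ˢ T, (σ p.1 * p.2) • U) :=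
        (measure_biUnion_finset hdisj fun p _ => (hUo.smul _).measurableSet).symm
    _ ≤ μ (V ^ ((m + 2) * n)) := measure_mono hsub

end Volume

/-! ### Compact kernel and properness. -/

section Proper

open Topology MeasureTheory

variable {G : Type*} [Group G] [TopologicalSpace G] [IsTopologicalGroup G] [T2Space G]
  [LocallyCompactSpace G]

/-- In a nilpotent group generated by a compact neighbourhood of `1`, the kernel of an open
surjective continuous endomorphism is compact. -/
theorem isCompact_ker_of_isNilpotent [Group.IsNilpotent G]
    {V : Set G} (hV : IsCompact V) (hV1 : V ∈ 𝓝 (1 : G)) (hVg : ∀ x : G, ∃ n : ℕ, x ∈ V ^ n)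
    {φ : G →* G} (hφ : Continuous φ) (hφo : IsOpenMap φ) (hφs : Function.Surjective φ) :
    IsCompact (φ.ker : Set G) := by
  by_contra hker
  let : MeasurableSpace G := borel G
  have : BorelSpace G := ⟨rfl⟩
  let μ : Measure G := Measure.haar
  obtain ⟨d, hd⟩ := exists_measure_pow_le_of_isNilpotent μ hV hV1
  obtain ⟨M, hM, hgrow⟩ := exists_mul_measure_pow_le μ hV hV1 hVg hφ hφo hφs hker
  -- Scaling `n` by `M` scales the polynomial bound by only `M ^ d`.
  obtain ⟨n₁, hn₁, hgrow⟩ := hgrow (M ^ (d + 1))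
  have hlow : ∀ j : ℕ, ((M ^ (d + 1)) ^ j : ENNReal) * μ (V ^ n₁) ≤ μ (V ^ (M ^ j * n₁)) := by
    intro j
    induction j with
    | zero => simp
    | succ j ih =>
      calc ((M ^ (d + 1)) ^ (j + 1) : ENNReal) * μ (V ^ n₁)
          = (M ^ (d + 1) : ENNReal) * (((M ^ (d + 1)) ^ j : ENNReal) * μ (V ^ n₁)) := by ring
        _ ≤ (M ^ (d + 1) : ENNReal) * μ (V ^ (M ^ j * n₁)) := by gcongr
        _ ≤ μ (V ^ (M * (M ^ j * n₁))) := by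
            have := hgrow (M ^ j * n₁) (Nat.le_mul_of_pos_left _ (by positivity))
            simpa using this
        _ = _ := by rw [← mul_assoc, ← pow_succ']
  have hbound : ∀ j : ℕ, (M ^ j : ENNReal) * μ (V ^ n₁) ≤ n₁ ^ d * μ V := by
    intro j
    have h := (hlow j).trans (hd (M ^ j * n₁) (by positivity))
    have hMd0 : ((M : ENNReal) ^ (d * j)) ≠ 0 := pow_ne_zero _ (by
      rw [Nat.cast_ne_zero]; omega)
    have hMdt : ((M : ENNReal) ^ (d * j)) ≠ ⊤ := ENNReal.pow_ne_top (ENNReal.natCast_ne_top M)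
    refine (ENNReal.mul_le_mul_iff_right hMd0 hMdt).1 ?_
    calc (M : ENNReal) ^ (d * j) * (M ^ j * μ (V ^ n₁))
        = (M ^ (d + 1)) ^ j * μ (V ^ n₁) := by ring
      _ ≤ _ := h
      _ = _ := by push_cast; ring
  have hpos : μ (V ^ n₁) ≠ 0 := by
    refine (Measure.measure_pos_of_mem_nhds μ (x := 1) ?_).ne'
    exact Filter.mem_of_superset hV1 (Set.subset_pow (mem_of_mem_nhds hV1) hn₁)
  obtain ⟨k, hk⟩ := ENNReal.exists_nat_mul_gt hpos
    (ENNReal.mul_ne_top (ENNReal.pow_ne_top (n := d) (ENNReal.natCast_ne_top n₁))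
      (hV.measure_lt_top (μ := μ)).ne)
  refine absurd (hbound k) (not_le.2 (hk.trans_le ?_))
  gcongr
  exact_mod_cast (Nat.lt_pow_self (by omega : 1 < M)).le

/-- A continuous surjective endomorphism of a connected locally compact σ-compact nilpotent group
is proper. -/
theorem MonoidHom.isProperMap_of_isNilpotent [SigmaCompactSpace G] [ConnectedSpace G]
    [Group.IsNilpotent G] (φ : G →* G) (hφ : Continuous φ) (hφs : Function.Surjective φ) :
    IsProperMap φ := by
  have hφo : IsOpenMap φ := φ.isOpenMap_of_sigmaCompact hφs hφ
  obtain ⟨C, hC, hC1⟩ := exists_compact_mem_nhds (1 : G)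
  have hV : IsCompact (C ∪ C⁻¹) := hC.union hC.inv
  have hV1 : C ∪ C⁻¹ ∈ 𝓝 (1 : G) := Filter.mem_of_superset hC1 Set.subset_union_left
  have hVg := exists_mem_pow_of_connectedSpace hV1
    (by rw [Set.union_inv, inv_inv, Set.union_comm])
  have hker := isCompact_ker_of_isNilpotent hV hV1 hVg hφ hφo hφs
  refine isProperMap_iff_isCompact_preimage.2 ⟨hφ, fun K hK => ?_⟩
  -- The preimage of `K` is then a closed subset of the compact set `V ^ n * ker φ`, for `V = C ∪
  -- C⁻¹`.
  obtain ⟨n, hn⟩ := hK.exists_subset_image_pow hV1 hVg hφo hφs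
  refine ((hV.set_pow n).mul hker).of_isClosed_subset (hK.isClosed.preimage hφ) fun x hx => ?_
  obtain ⟨y, hy, e⟩ := hn hx
  exact ⟨y, hy, y⁻¹ * x, by simp [MonoidHom.mem_ker, e], by simp⟩

end Proper

theorem mainTheorem11
    {E : Type*} [NormedAddCommGroup E] [NormedSpace ℝ E] [FiniteDimensional ℝ E]
    {G : Type*} [Group G] [TopologicalSpace G] [T2Space G] [SecondCountableTopology G]
    [ChartedSpace E G] [LieGroup 𝓘(ℝ, E) ∞ G]
    [ConnectedSpace G] [Group.IsNilpotent G]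
    (φ : ContMDiffMonoidMorphism 𝓘(ℝ, E) 𝓘(ℝ, E) ∞ G G)
    (hφ : Function.Surjective φ) :
    IsProperMap φ := by
  have : IsTopologicalGroup G := topologicalGroup_of_lieGroup 𝓘(ℝ, E) ∞
  have : ProperSpace E := FiniteDimensional.proper_real E
  have : LocallyCompactSpace G := ChartedSpace.locallyCompactSpace E G
  exact φ.toMonoidHom.isProperMap_of_isNilpotent φ.contMDiff_toFun.continuous hφ
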